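/- **Conventions.** A chain is a linearly ordered set. A chain $A$ is *uniform* if its tails $\{y\in A: y\ge x\}$, $x\in A$, are pairwise isomorphic; for a uniform chain $U$ write $\mathrm{f}U$ for the common isomorphism type of its tails. For $x\in A$ define the $\alpha$-components by $c_0(x)=\{x\}$; $y\in c_{\alpha+1}(x)$ iff only finitely many $\alpha$-components meet the closed interval between $x$ and $y$; and $c_\lambda(x)=\bigcup_{\beta<\lambda}c_\beta(x)$ for limit $\lambda$. The chain $A$ has *rank* $\alpha$ if $\alpha$ is the least ordinal with $c_\alpha(x)=A$ for all $x\in A$. $\mathrm{UC}(\alpha)$ is the class of uniform chains of rank $\alpha$, and $\mathrm{UC}(\omega,\omega+\omega)$ that of the uniform chains of rank $\alpha$ with $\omega\le\alpha<\omega+\omega$. $A+B$ is the ordered sum, and $A\cdot\mathbb N$, $A\cdot\mathbb Z$ are the ordered sums of $\mathbb N$, respectively $\mathbb Z$, copies of $A$. $\mathrm{SS}(n+1)$ is the set of sequences $s=\langle s(0),\dots,s(n)\rangle$ of natural numbers with $s(i)\le i$ for all $i$. For $n\ge 1$ let $s^-=\langle s(0),\dots,s(n-1)\rangle$, and, if $s(n)<n$,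 let $s^+=\langle s(0),\dots,s(n-2),s(n)\rangle$. The tree of $s$ is the binary tree with root $\langle s;0\rangle$ in which a node $\langle t;k\rangle$ with $t\in\mathrm{SS}(m+1)$, $m\ge1$, has the extensions $\langle t^+;k+1\rangle$ (left) and $\langle t^-;0\rangle$ (right) if $t(m)<m$, and the only extension $\langle t^-;0\rangle$ if $t(m)=m$; the nodes $\langle\langle 0\rangle;k\rangle$ are the leaves. Let $\mathrm{lf}(s)$ be the number of leaves, let $\mathrm{wt}^s(i)=k$ if the $i$-th leaf from the left ($0\le i<\mathrm{lf}(s)$) is $\langle\langle0\rangle;k\rangle$, and let $\mathrm{rwt}^s$ be the range of $\mathrm{wt}^s$. For chains $M_0,\dots,M_{\mathrm{lf}(s)-1}$ define $A(\langle 0\rangle)[M_0]=M_0$ and, for $s\in\mathrm{SS}(n+1)$ with $n\ge 1$, $$A(s)[M_0,\dots,M_{\mathrm{lf}(s)-1}]=\begin{cases}A(s^-)[M_0,\dots,M_{\mathrm{lf}(s^-)-1}]\cdot\mathbb Z & \text{if } s(n)=n,\\ A(s^+)[M_0,\dots,M_{\mathrm{lf}(s^+)-1}]+A(s^-)[M_{\mathrm{lf}(s^+)},\dots,M_{\mathrm{lf}(s)-1}]\cdot\mathbb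 N & \text{if } s(n)<n.\end{cases}$$ A *tagged short array* for $s$ is a family $(U_k)_{k\in\mathrm{rwt}^s}$ of chains in $\mathrm{UC}(\omega)$ with $\mathrm{f}U_k\cong \mathrm{f}U_l$ for all $k,l\in\mathrm{rwt}^s$. For such a family put $A(s)\langle\langle (U_k,k)\rangle\rangle_{k\in\mathrm{rwt}^s}:=A(s)[M_0,\dots,M_{\mathrm{lf}(s)-1}]$ with $M_i=U_{\mathrm{wt}^s(i)}$. **Statement.** (1) For every $n\ge0$, every $s\in\mathrm{SS}(n+1)$ and every tagged short array $(U_k)_{k\in\mathrm{rwt}^s}$ for $s$, the chain $A(s)\langle\langle (U_k,k)\rangle\rangle_{k\in\mathrm{rwt}^s}$ is a uniform chain of rank $\omega+n$. (2) Conversely, for every chain $A\in\mathrm{UC}(\omega,\omega+\omega)$, of rank $\omega+n$ say ($n\ge 0$), there are $s\in\mathrm{SS}(n+1)$ and a tagged short array $(U_k)_{k\in\mathrm{rwt}^s}$ for $s$ with $A\cong A(s)\langle\langle (U_k,k)\rangle\rangle_{k\in\mathrm{rwt}^s}$. -/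

import Mathlib

universe u

open Ordinal

namespace UniformChain

/-- The `α`-component of `x` in the chain `A` (iterated finite condensation): the `0`-component of
`x` is `{x}`; `y` lies in the `(α + 1)`-component of `x` when only finitely many `α`-components meet
the closed interval between `x` and `y`; at limits one takes unions. The quotient `A / α` is the
chain of all `α`-components. -/
noncomputable def component {A : Type u} [LinearOrder A] (α : Ordinal.{u}) : A → Set A :=
  Ordinal.limitRecOn (motive := fun _ => A → Set A) α
    (fun x => {x})
    (fun _ C x => {y | (C '' Set.uIcc x y).Finite})
    (fun l _ C x => ⋃ (b : Ordinal.{u}) (hb : b < l), C b hb x)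

theorem component_zero {A : Type u} [LinearOrder A] (x : A) :
    component (0 : Ordinal.{u}) x = {x} := by
  simp [component]

theorem component_succ {A : Type u} [LinearOrder A] (α : Ordinal.{u}) (x : A) :
    component (Order.succ α) x = {y | (component α '' Set.uIcc x y).Finite} := by
  simp [component]

theorem component_limit {A : Type u} [LinearOrder A] (l : Ordinal.{u})
    (hl : Order.IsSuccLimit l) (x : A) :
    component l x = ⋃ (b : Ordinal.{u}) (_ : b < l), component b x := by
  simp [component, Ordinal.limitRecOn_limit _ _ _ _ hl]

/-- `A` has rank `α`: `α` is least such that all of `A` is a single `α`-component. -/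
def HasRank (A : Type u) [LinearOrder A] (α : Ordinal.{u}) : Prop :=
  (∀ x : A, component α x = Set.univ) ∧
    ∀ β < α, ¬ ∀ x : A, component β x = Set.univ

/-- A chain is uniform if its tails `{y | x ≤ y}` are pairwise isomorphic. -/
def IsUniform (A : Type u) [LinearOrder A] : Prop :=
  ∀ x y : A, Nonempty (Set.Ici x ≃o Set.Ici y)

/-- `A ∈ UC(α)`: `A` is a uniform chain of rank `α`. -/
def UC (A : Type u) [LinearOrder A] (α : Ordinal.{u}) : Prop :=
  IsUniform A ∧ HasRank A α

/-- The tails of `A` are isomorphic to the tails of `B`. -/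
def TailsIso (A B : Type u) [LinearOrder A] [LinearOrder B] : Prop :=
  ∀ (x : A) (y : B), Nonempty (Set.Ici x ≃o Set.Ici y)

/-- `SS n`: the sequences `s = ⟨s(0), …, s(n - 1)⟩` of length `n` with `s(i) ≤ i`. -/
def SS (n : ℕ) : Set (Fin n → ℕ) := {s | ∀ i, s i ≤ (i : ℕ)}

/-- `s⁻`: remove the last entry of `s`. -/
def minus {n : ℕ} (s : Fin (n + 2) → ℕ) : Fin (n + 1) → ℕ := Fin.init s

/-- `s⁺`: remove the last but one entry of `s`. For `s ∈ SS (n + 2)` one has `s⁺ ∈ SS (n + 1)` iff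
the last entry of `s` is less than `n + 1`. -/
def plus {n : ℕ} (s : Fin (n + 2) → ℕ) : Fin (n + 1) → ℕ :=
  Function.update (Fin.init s) (Fin.last n) (s (Fin.last (n + 1)))

/-- The leaves, from left to right, of the binary tree with root `⟨s; k⟩`, each leaf `⟨⟨0⟩; j⟩` being
recorded by its weight `j`. A node `⟨t; k⟩` has the extensions `⟨t⁺; k + 1⟩` (to the left) and
`⟨t⁻; 0⟩` (to the right) if `t⁺` is in `SS`, and otherwise the only extension `⟨t⁻; 0⟩`; the nodes
with `t` of length one are the leaves. -/
def leafWeights : {n : ℕ} → (Fin (n + 1) → ℕ) → ℕ → List ℕ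
  | 0, _, k => [k]
  | n + 1, s, k =>
    if s (Fin.last (n + 1)) < n + 1 then
      leafWeights (plus s) (k + 1) ++ leafWeights (minus s) 0
    else
      leafWeights (minus s) 0

/-- The number of leaves of the tree of `s`, whose root is `⟨s; 0⟩`. -/
def lf {n : ℕ} (s : Fin (n + 1) → ℕ) : ℕ := (leafWeights s 0).length

/-- The weight of the `i`-th leaf of the tree of `s` (for `i < lf s`). -/
def wt {n : ℕ} (s : Fin (n + 1) → ℕ) (i : ℕ) : ℕ := (leafWeights s 0).getD i 0

/-- The set of weights occurring in the tree of `s`. -/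
def rwt {n : ℕ} (s : Fin (n + 1) → ℕ) : Set ℕ := wt s '' {i | i < lf s}

/-- The chain `A(s)[M 0, …, M (lf s - 1)]`. Here `⊕ₗ` is the ordered sum, and `ℕ ×ₗ B`, `ℤ ×ₗ B` are
the ordered sums of `ℕ`, respectively `ℤ`, copies of `B`. Only the first `lf s` entries of `M` are
used. -/
def longChain : {n : ℕ} → (Fin (n + 1) → ℕ) → (ℕ → LinOrd.{u}) → LinOrd.{u}
  | 0, _, M => M 0
  | n + 1, s, M =>
    if s (Fin.last (n + 1)) < n + 1 then
      LinOrd.of (longChain (plus s) M ⊕ₗ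
        (ℕ ×ₗ longChain (minus s) (fun i => M (lf (plus s) + i))))
    else
      LinOrd.of (ℤ ×ₗ longChain (minus s) M)

/-- The chain `A(s)⟨⟨(U k, k) : k ∈ rwt s⟩⟩`, that is `A(s)[M 0, …, M (lf s - 1)]` for
`M i = U (wt s i)`. Only the `U k` with `k ∈ rwt s` are used. -/
def shortChain {n : ℕ} (s : Fin (n + 1) → ℕ) (U : ℕ → LinOrd.{u}) : LinOrd.{u} :=
  longChain s (fun i => U (wt s i))

/-- `{(U k, k) : k ∈ rwt s}` is a tagged short array: the `U k` are uniform chains of rank `ω` whose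
tails are pairwise isomorphic. -/
def IsTaggedShortArray {n : ℕ} (s : Fin (n + 1) → ℕ) (U : ℕ → LinOrd.{u}) : Prop :=
  (∀ k ∈ rwt s, UC (U k) ω) ∧ ∀ k ∈ rwt s, ∀ l ∈ rwt s, TailsIso (U k) (U l)

end UniformChain

/-!
Components are convex equivalence classes, and they are local: whether `y` lies in the component of
`x` can be decided inside any convex set containing both, so isomorphisms of tails preserve
components (`mem_component_map_iff`, `exists_tail_map`).

Let `A` be uniform of rank `β + 1`. Its `β`-components form a chain with finite intervals and no
maximum, that is, a copy of `ℤ` or `ℕ` (`UC.exists_index`). Each of them is uniform of rank `β`.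
The component immediately above that of `x` is determined by the tail at `x`; as all tails are
isomorphic, all components but a possible first one are isomorphic to one chain `L`, and `L` depends
only on the tails of `A`. So `A` is `L · ℤ`, or `M + L · ℕ` where the first component `M` has the
tails of `L` (`UC.exists_decomposition`). Conversely these sums are uniform of rank `β + 1`, with
tails `T + L · ℕ`, `T` a tail of `L`. The rank is as claimed because a uniform chain of rank `β`
never shares a `β`-component with a point beyond it (`UC.not_mem_component`).

The recursion on the tree of `s` iterates this step, starting from rank `ω`. The tails of `A(s)`
depend on `s⁻` and on the array, but not on the last entry of `s`. Hence `A(s⁺)` and `A(s⁻)` have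
the same tails, and the chain of `s` is uniform (`uc_tagChain`). In the other direction the induction
is on the following stronger claim (`exists_tagChain`): *all* uniform chains of rank `ω + n` with the
tails of a given one are obtained from one `s` and one array by changing only the last entry of `s`
and the array entry of index `n`. Applied to `L`, it yields `L` and `M` from the same data; the last
entry of the new sequence then says which of the `n + 2` shapes `A` has. No uniqueness of the
representation is needed.
-/

namespace UniformChain

/-! ### Components -/

section Components

variable {A B : Type u} [LinearOrder A] [LinearOrder B]

theorem mem_component_add_one {α : Ordinal.{u}} {x y : A} :
    y ∈ component (α + 1) x ↔ (component α '' Set.uIcc x y).Finite := by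
  rw [← Order.succ_eq_add_one, component_succ]
  rfl

/-- Components of order `α` are the convex classes of an equivalence relation, and they increase with
`α`. The claims need a common induction: transitivity at a limit uses monotonicity below it, and
monotonicity at a successor uses that the smaller components are convex classes. -/
theorem component_properties (α : Ordinal.{u}) :
    (∀ x : A, x ∈ component α x) ∧
    (∀ x y : A, y ∈ component α x → x ∈ component α y) ∧
    (∀ x y z : A, y ∈ component α x → z ∈ component α y → z ∈ component α x) ∧
    (∀ x y z : A, y ∈ component α x → z ∈ Set.uIcc x y → z ∈ component α x) ∧
    ∀ β ≤ α, ∀ x : A, component β x ⊆ component α x := by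
  induction α using Ordinal.limitRecOn with
  | zero =>
    refine ⟨?_, ?_, ?_, ?_, ?_⟩
    · simp [component_zero]
    · simp +contextual [component_zero]
    · simp +contextual [component_zero]
    · simp +contextual [component_zero]
    · intro β hβ x
      rw [nonpos_iff_eq_zero.mp hβ]
  | add_one α ih =>
    obtain ⟨hr, hs, ht, hc, hm⟩ := ih
    refine ⟨?_, ?_, ?_, ?_, ?_⟩
    · simp [mem_component_add_one]
    · intro x y h
      rw [mem_component_add_one] at h ⊢
      rwa [Set.uIcc_comm]
    · intro x y z hy hz
      rw [mem_component_add_one] at hy hz ⊢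
      refine (hy.union hz).subset ?_
      rw [← Set.image_union]
      exact Set.image_mono Set.uIcc_subset_uIcc_union_uIcc
    · intro x y z hy hz
      rw [mem_component_add_one] at hy ⊢
      exact hy.subset (Set.image_mono (Set.uIcc_subset_uIcc_left hz))
    · have hsucc : ∀ x : A, component α x ⊆ component (α + 1) x := by
        intro x y hy
        rw [mem_component_add_one]
        refine (Set.finite_singleton (component α x)).subset ?_
        rintro _ ⟨z, hz, rfl⟩
        have hzx := hc x y z hy hz
        exact Set.ext fun w => ⟨ht x z w hzx, ht z x w (hs x z hzx)⟩
      intro β hβ x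
      rcases hβ.eq_or_lt with rfl | hlt
      · exact subset_rfl
      · exact (hm β (Order.lt_add_one_iff.mp hlt) x).trans (hsucc x)
  | limit l hl ih =>
    have hmem : ∀ x y : A, y ∈ component l x ↔ ∃ b < l, y ∈ component b x := by
      intro x y
      simp [component_limit l hl]
    refine ⟨?_, ?_, ?_, ?_, ?_⟩
    · intro x
      exact (hmem x x).2 ⟨0, hl.bot_lt, (ih 0 hl.bot_lt).1 x⟩
    · intro x y h
      obtain ⟨b, hb, h⟩ := (hmem x y).1 h
      exact (hmem y x).2 ⟨b, hb, (ih b hb).2.1 x y h⟩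
    · intro x y z hy hz
      obtain ⟨b, hb, hy⟩ := (hmem x y).1 hy
      obtain ⟨b', hb', hz⟩ := (hmem y z).1 hz
      have hmax : max b b' < l := max_lt hb hb'
      obtain ⟨-, -, ht, -, hm⟩ := ih _ hmax
      exact (hmem x z).2 ⟨_, hmax,
        ht x y z (hm b (le_max_left _ _) x hy) (hm b' (le_max_right _ _) y hz)⟩
    · intro x y z hy hz
      obtain ⟨b, hb, hy⟩ := (hmem x y).1 hy
      exact (hmem x z).2 ⟨b, hb, (ih b hb).2.2.2.1 x y z hy hz⟩
    · intro β hβ x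
      rcases hβ.eq_or_lt with rfl | hlt
      · exact subset_rfl
      · exact fun y hy => (hmem x y).2 ⟨β, hlt, hy⟩

theorem mem_component_self (α : Ordinal.{u}) (x : A) : x ∈ component α x :=
  (component_properties α).1 x

theorem mem_component_comm {α : Ordinal.{u}} {x y : A} :
    y ∈ component α x ↔ x ∈ component α y :=
  ⟨(component_properties α).2.1 x y, (component_properties α).2.1 y x⟩

theorem mem_component_trans {α : Ordinal.{u}} {x y z : A} (hy : y ∈ component α x)
    (hz : z ∈ component α y) : z ∈ component α x :=
  (component_properties α).2.2.1 x y z hy hz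

theorem mem_component_of_mem_uIcc {α : Ordinal.{u}} {x y z : A} (hy : y ∈ component α x)
    (hz : z ∈ Set.uIcc x y) : z ∈ component α x :=
  (component_properties α).2.2.2.1 x y z hy hz

theorem component_mono {α β : Ordinal.{u}} (h : β ≤ α) (x : A) :
    component β x ⊆ component α x :=
  (component_properties α).2.2.2.2 β h x

theorem component_eq_iff {α : Ordinal.{u}} {x y : A} :
    component α x = component α y ↔ y ∈ component α x := by
  refine ⟨fun h => h ▸ mem_component_self α y, fun h => Set.ext fun z => ?_⟩
  exact ⟨mem_component_trans (mem_component_comm.1 h), mem_component_trans h⟩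

theorem ordConnected_component (α : Ordinal.{u}) (x : A) : (component α x).OrdConnected := by
  refine ⟨fun y hy z hz w hw => ?_⟩
  exact mem_component_trans hy (mem_component_of_mem_uIcc
    (mem_component_trans (mem_component_comm.1 hy) hz) (Set.Icc_subset_uIcc hw))

/-- Components are local: they are preserved by isomorphisms between convex subsets. -/
theorem mem_component_map_iff {f : A → B} {S : Set A} (hf : StrictMonoOn f S)
    (hS : S.OrdConnected) (hfS : (f '' S).OrdConnected) (α : Ordinal.{u}) :
    ∀ x ∈ S, ∀ y ∈ S, f y ∈ component α (f x) ↔ y ∈ component α x := by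
  induction α using Ordinal.limitRecOn with
  | zero =>
    intro x hx y hy
    simpa [component_zero] using hf.injOn.eq_iff hy hx
  | add_one α ih =>
    intro x hx y hy
    have hsub : Set.uIcc x y ⊆ S := hS.uIcc_subset hx hy
    have himage : Set.uIcc (f x) (f y) = f '' Set.uIcc x y := by
      refine subset_antisymm (fun w hw => ?_) ?_
      · obtain ⟨z, hz, rfl⟩ :=
          hfS.uIcc_subset (Set.mem_image_of_mem f hx) (Set.mem_image_of_mem f hy) hw
        refine ⟨z, ?_, rfl⟩
        rw [Set.mem_uIcc] at hw ⊢
        simpa only [hf.le_iff_le hx hz, hf.le_iff_le hz hy, hf.le_iff_le hy hz,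
          hf.le_iff_le hz hx] using hw
      · rintro _ ⟨z, hz, rfl⟩
        have hzS := hsub hz
        rw [Set.mem_uIcc] at hz ⊢
        simpa only [hf.le_iff_le hx hzS, hf.le_iff_le hzS hy, hf.le_iff_le hy hzS,
          hf.le_iff_le hzS hx] using hz
    -- so `z ↦ component α z` and `z ↦ component α (f z)` identify the same points of the interval,
    -- and one takes finitely many values there iff the other does
    have hiff : ∀ z ∈ Set.uIcc x y, ∀ w ∈ Set.uIcc x y,
        component α (f z) = component α (f w) ↔ component α z = component α w := by
      intro z hz w hw
      rw [component_eq_iff, component_eq_iff, ih z (hsub hz) w (hsub hw)]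
    rw [mem_component_add_one, mem_component_add_one, himage,
      Set.image_image]
    obtain ⟨t, ht, htb⟩ := Set.exists_subset_bijOn (Set.uIcc x y) (component α)
    obtain ⟨t', ht', htb'⟩ := Set.exists_subset_bijOn (Set.uIcc x y) fun z => component α (f z)
    constructor
    · intro h
      rw [← htb.image_eq]
      refine Set.Finite.image _ (Set.Finite.of_finite_image (h.subset (Set.image_mono ht)) ?_)
      exact fun z hz w hw h => htb.injOn hz hw ((hiff z (ht hz) w (ht hw)).1 h)
    · intro h
      rw [← htb'.image_eq]
      refine Set.Finite.image _ (Set.Finite.of_finite_image (h.subset (Set.image_mono ht')) ?_)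
      exact fun z hz w hw h => htb'.injOn hz hw ((hiff z (ht' hz) w (ht' hw)).2 h)
  | limit l hl ih =>
    intro x hx y hy
    simp only [component_limit l hl, Set.mem_iUnion]
    exact exists_congr fun b => exists_congr fun hb => ih b hb x hx y hy

end Components

/-! ### Isomorphisms of tails -/

section Tails

variable {A B : Type u} [LinearOrder A] [LinearOrder B]

theorem exists_strictMonoOn_of_orderIso {S : Set A} {T : Set B} (hT : T.Nonempty) (e : S ≃o T) :
    ∃ f : A → B, StrictMonoOn f S ∧ f '' S = T := by
  classical
  obtain ⟨b, -⟩ := hT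
  refine ⟨fun z => if h : z ∈ S then e ⟨z, h⟩ else b, ?_, ?_⟩
  · intro z hz w hw hzw
    simp only [hz, hw, dif_pos, Subtype.coe_lt_coe, e.lt_iff_lt]
    exact hzw
  · ext w
    constructor
    · rintro ⟨z, hz, rfl⟩
      simp only [hz, dif_pos]
      exact (e ⟨z, hz⟩).2
    · intro hw
      refine ⟨e.symm ⟨w, hw⟩, (e.symm ⟨w, hw⟩).2, ?_⟩
      simp

theorem nonempty_orderIso_image {f : A → B} {S : Set A} {T : Set B} (hf : StrictMonoOn f S)
    (hT : f '' S = T) : Nonempty (S ≃o T) :=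
  ⟨(hf.orderIso f S).trans (OrderIso.setCongr _ _ hT)⟩

/-- An isomorphism of tails, as a function on the ambient chains. It preserves components of every
order. -/
theorem exists_tail_map {x : A} {y : B} (h : Nonempty (Set.Ici x ≃o Set.Ici y)) :
    ∃ f : A → B, StrictMonoOn f (Set.Ici x) ∧ f '' Set.Ici x = Set.Ici y ∧ f x = y ∧
      ∀ α : Ordinal.{u}, ∀ z, x ≤ z → ∀ w, x ≤ w →
        (f w ∈ component α (f z) ↔ w ∈ component α z) := by
  obtain ⟨e⟩ := h
  obtain ⟨f, hf, himage⟩ := exists_strictMonoOn_of_orderIso ⟨y, Set.self_mem_Ici⟩ e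
  refine ⟨f, hf, himage, ?_, fun α => mem_component_map_iff hf Set.ordConnected_Ici
    (himage ▸ Set.ordConnected_Ici) α⟩
  obtain ⟨z, hz, hzy⟩ : y ∈ f '' Set.Ici x := himage ▸ Set.self_mem_Ici
  have hx : f x ∈ Set.Ici y := himage ▸ Set.mem_image_of_mem f Set.self_mem_Ici
  refine le_antisymm ?_ hx
  rw [← hzy]
  exact hf.monotoneOn Set.self_mem_Ici hz hz

theorem TailsIso.symm (h : TailsIso A B) : TailsIso B A :=
  fun x y => ⟨(h y x).some.symm⟩

theorem TailsIso.trans {C : Type u} [LinearOrder C] [Nonempty B] (h : TailsIso A B)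
    (h' : TailsIso B C) : TailsIso A C :=
  fun x y => ⟨(h x (Classical.arbitrary B)).some.trans (h' (Classical.arbitrary B) y).some⟩

theorem TailsIso.ici_subset_component (h : TailsIso A B) {β γ : Ordinal.{u}} {x : A}
    (hx : Set.Ici x ∩ component β x ⊆ component γ x) (y : B) :
    Set.Ici y ∩ component β y ⊆ component γ y := by
  rintro z ⟨hz, hzβ⟩
  obtain ⟨f, -, himage, rfl, hcomp⟩ := exists_tail_map (h x y)
  rw [← himage] at hz
  obtain ⟨w, hw, rfl⟩ := hz
  rw [hcomp β x le_rfl w hw] at hzβ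
  exact (hcomp γ x le_rfl w hw).2 (hx ⟨hw, hzβ⟩)

/-- In a uniform chain, if `β`-components are `γ`-components on a single tail, they are so
throughout. -/
theorem IsUniform.component_subset_component (hA : IsUniform A) {β γ : Ordinal.{u}} {x : A}
    (hx : Set.Ici x ∩ component β x ⊆ component γ x) (y : A) : component β y ⊆ component γ y := by
  have key : ∀ y : A, Set.Ici y ∩ component β y ⊆ component γ y :=
    TailsIso.ici_subset_component hA hx
  intro z hz
  rcases le_total y z with h | h
  · exact key y ⟨h, hz⟩
  · exact mem_component_comm.1 (key z ⟨h, mem_component_comm.1 hz⟩)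

/-- In a uniform chain, a single tail contained in one component forces every component of that
order to be the whole chain. -/
theorem IsUniform.component_eq_univ (hA : IsUniform A) {γ : Ordinal.{u}} {x : A}
    (hx : Set.Ici x ⊆ component γ x) (y : A) : component γ y = Set.univ := by
  have key : ∀ y : A, Set.Ici y ⊆ component γ y := by
    intro y z hz
    obtain ⟨f, -, himage, rfl, hcomp⟩ := exists_tail_map (hA x y)
    rw [← himage] at hz
    obtain ⟨w, hw, rfl⟩ := hz
    exact (hcomp γ x le_rfl w hw).2 (hx hw)
  refine Set.eq_univ_of_forall fun z => ?_
  rcases le_total y z with h | h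
  · exact key y h
  · exact mem_component_comm.1 (key z h)

/-- A uniform chain of rank `β` that is a convex part of a chain, bounded above by `y`, does not meet
the `β`-component of `y`: otherwise a tail of it would lie in a `γ`-component for some `γ < β`. -/
theorem UC.not_mem_component {L : Type u} [LinearOrder L] {β : Ordinal.{u}} (hL : UC L β)
    {f : L → B} (hf : StrictMono f) (hrange : (Set.range f).OrdConnected) {y : B}
    (hy : ∀ a, f a < y) (x : L) : y ∉ component β (f x) := by
  have hcomp : ∀ (γ : Ordinal.{u}) (z w : L),
      f w ∈ component γ (f z) ↔ w ∈ component γ z := fun γ z w =>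
    mem_component_map_iff (hf.strictMonoOn Set.univ) Set.ordConnected_univ
      (by rwa [Set.image_univ]) γ z trivial w trivial
  have hrank : ∀ γ < β, ∀ z : L, ¬ Set.Ici z ⊆ component γ z := fun γ hγ z hz =>
    hL.2.2 γ hγ (hL.1.component_eq_univ hz)
  intro hmem
  induction β using Ordinal.limitRecOn with
  | zero =>
    rw [component_zero] at hmem
    exact (hy x).ne' hmem
  | add_one γ _ =>
    rw [mem_component_add_one] at hmem
    obtain ⟨t, ht, htb⟩ := Set.exists_subset_bijOn (Set.Ici x) (component γ)
    have htfin : t.Finite := by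
      refine Set.Finite.of_finite_image (f := fun z => component γ (f z)) (hmem.subset ?_) ?_
      · rintro _ ⟨z, hz, rfl⟩
        refine ⟨f z, ?_, rfl⟩
        exact Set.Icc_subset_uIcc ⟨hf.monotone (ht hz), (hy z).le⟩
      · intro z hz w hw h
        refine htb.injOn hz hw ?_
        exact component_eq_iff.2 ((hcomp γ z w).1 (component_eq_iff.1 h))
    have htne : t.Nonempty := by
      have : (component γ '' t).Nonempty := by
        rw [htb.image_eq]
        exact ⟨_, x, Set.self_mem_Ici, rfl⟩
      exact this.of_image
    -- the greatest representative lies in the last `γ`-component that meets the tail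
    obtain ⟨z, hz, hmax⟩ := Set.exists_max_image t id htfin htne
    refine hrank γ (Order.lt_add_one_iff.2 le_rfl) z fun w hw => ?_
    have hw' : component γ w ∈ component γ '' t := by
      rw [htb.image_eq]
      exact ⟨w, (ht hz : x ≤ z).trans hw, rfl⟩
    obtain ⟨v, hv, hvw⟩ := hw'
    have hzv : z ∈ component γ v := mem_component_of_mem_uIcc (component_eq_iff.1 hvw)
      (Set.Icc_subset_uIcc ⟨hmax v hv, hw⟩)
    exact mem_component_trans (mem_component_comm.1 hzv) (component_eq_iff.1 hvw)
  | limit l hl _ =>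
    simp only [component_limit l hl, Set.mem_iUnion] at hmem
    obtain ⟨γ, hγ, hmem⟩ := hmem
    refine hrank γ hγ x fun z hz => (hcomp γ x z).1 ?_
    exact mem_component_of_mem_uIcc hmem
      (Set.Icc_subset_uIcc ⟨hf.monotone hz, (hy z).le⟩)

end Tails

/-! ### Sums of uniform chains -/

section Sums

variable {A B L M : Type u} [LinearOrder A] [LinearOrder B] [LinearOrder L] [LinearOrder M]

/-- If a chain is cut, along a locally finite index chain without maximum, into uniform pieces of
rank `β`, then these pieces are its `β`-components, and its rank is `β + 1`. -/
theorem hasRank_add_one_of_fibers {I : Type*} [LinearOrder I] [LocallyFiniteOrder I] [NoMaxOrder I]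
    [Nonempty I] {β : Ordinal.{u}} {r : B → I} (hr : Monotone r)
    (hfib : ∀ i, ∃ (C : Type u) (_ : LinearOrder C) (f : C → B), Nonempty C ∧ UC C β ∧
      StrictMono f ∧ Set.range f = r ⁻¹' {i}) : HasRank B (β + 1) := by
  have hconn : ∀ i, (r ⁻¹' {i}).OrdConnected := fun i => Set.ordConnected_singleton.preimage_mono hr
  have hsurj : ∀ i, ∃ x, r x = i := by
    intro i
    obtain ⟨C, _, f, ⟨c⟩, -, -, hf⟩ := hfib i
    have : f c ∈ r ⁻¹' {i} := hf ▸ Set.mem_range_self c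
    exact ⟨f c, this⟩
  have hlt : ∀ x y, r x < r y → y ∉ component β x := by
    intro x y hxy
    obtain ⟨C, _, f, -, hC, hf, hrange⟩ := hfib (r x)
    obtain ⟨a, rfl⟩ : x ∈ Set.range f := hrange ▸ rfl
    refine hC.not_mem_component hf (hrange ▸ hconn _) (fun b => ?_) a
    have hb : r (f b) = r (f a) := (hrange ▸ Set.mem_range_self b : f b ∈ r ⁻¹' {r (f a)})
    exact hr.reflect_lt (hb ▸ hxy)
  have hcomp : ∀ x y, y ∈ component β x ↔ r y = r x := by
    intro x y
    constructor
    · intro hy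
      rcases lt_trichotomy (r x) (r y) with h | h | h
      · exact absurd hy (hlt x y h)
      · exact h.symm
      · exact absurd (mem_component_comm.1 hy) (hlt y x h)
    · intro hxy
      obtain ⟨C, _, f, -, hC, hf, hrange⟩ := hfib (r x)
      obtain ⟨a, rfl⟩ : x ∈ Set.range f := hrange ▸ rfl
      obtain ⟨b, rfl⟩ : y ∈ Set.range f := hrange ▸ hxy
      refine (mem_component_map_iff (hf.strictMonoOn Set.univ) Set.ordConnected_univ
        (by rw [Set.image_univ, hrange]; exact hconn _) β a trivial b trivial).2 ?_
      rw [hC.2.1 a]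
      trivial
  constructor
  · intro x
    refine Set.eq_univ_of_forall fun y => mem_component_add_one.2 ?_
    obtain ⟨t, ht, htb⟩ := Set.exists_subset_bijOn (Set.uIcc x y) (component β)
    rw [← htb.image_eq]
    refine Set.Finite.image _ (Set.Finite.of_finite_image
      ((Set.finite_Icc (r x ⊓ r y) (r x ⊔ r y)).subset ?_) (f := r) ?_)
    · rintro _ ⟨z, hz, rfl⟩
      have := ht hz
      exact ⟨by rw [← hr.map_inf]; exact hr this.1, by rw [← hr.map_sup]; exact hr this.2⟩
    · exact fun z hz w hw h => htb.injOn hz hw (component_eq_iff.2 ((hcomp z w).2 h.symm))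
  · intro γ hγ h
    obtain ⟨x, -⟩ := hsurj (Classical.arbitrary I)
    obtain ⟨i, hi⟩ := exists_gt (r x)
    obtain ⟨y, rfl⟩ := hsurj i
    have hy : y ∈ component γ x := h x ▸ Set.mem_univ y
    exact hlt x y hi (component_mono (Order.lt_add_one_iff.1 hγ) x hy)

theorem hasRank_int_prod {β : Ordinal.{u}} [Nonempty L] (hL : UC L β) :
    HasRank (ℤ ×ₗ L) (β + 1) := by
  refine hasRank_add_one_of_fibers (r := fun p : ℤ ×ₗ L => (ofLex p).1) Prod.Lex.monotone_fst ?_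
  refine fun i => ⟨L, _, fun a => toLex (i, a), inferInstance, hL, ?_, ?_⟩
  · exact fun a b h => Prod.Lex.toLex_lt_toLex.2 (Or.inr ⟨rfl, h⟩)
  · ext p
    obtain ⟨⟨j, a⟩, rfl⟩ := toLex.surjective p
    simp [Prod.ext_iff, eq_comm]

theorem hasRank_sum_nat_prod {β : Ordinal.{u}} [Nonempty L] [Nonempty M] (hM : UC M β)
    (hL : UC L β) : HasRank (M ⊕ₗ (ℕ ×ₗ L)) (β + 1) := by
  refine hasRank_add_one_of_fibers
    (r := fun p : M ⊕ₗ (ℕ ×ₗ L) => Sum.elim (fun _ => 0) (fun q => (ofLex q).1 + 1) (ofLex p))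
    ?_ ?_
  · intro p q h
    obtain ⟨p, rfl⟩ := toLex.surjective p
    obtain ⟨q, rfl⟩ := toLex.surjective q
    rcases p with p | p <;> rcases q with q | q
    · simp
    · simp
    · simp at h
    · rw [Sum.Lex.inr_le_inr_iff] at h
      simpa using Prod.Lex.monotone_fst _ _ h
  · rintro (_ | i)
    · refine ⟨M, _, fun a => toLex (Sum.inl a), inferInstance, hM, ?_, ?_⟩
      · exact fun a b h => Sum.Lex.inl_lt_inl_iff.2 h
      · ext p
        obtain ⟨p | p, rfl⟩ := toLex.surjective p <;> simp
    · refine ⟨L, _, fun a => toLex (Sum.inr (toLex (i, a))), inferInstance, hL, ?_, ?_⟩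
      · exact fun a b h => Sum.Lex.inr_lt_inr_iff.2 (Prod.Lex.toLex_lt_toLex.2 (Or.inr ⟨rfl, h⟩))
      · ext p
        obtain ⟨p | p, rfl⟩ := toLex.surjective p
        · simp
        · obtain ⟨⟨j, a⟩, rfl⟩ := toLex.surjective p
          simp [Prod.ext_iff, eq_comm]

theorem nonempty_ici_orderIso_of_range {X : Type*} [LinearOrder X] {f : X → A} (hf : StrictMono f)
    {a : A} (hrange : Set.range f = Set.Ici a) : Nonempty (Set.Ici a ≃o X) :=
  ⟨((hf.orderIso f).trans (OrderIso.setCongr _ _ hrange)).symm⟩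

/-- Tails of a sum of copies of `L`, when the indices beyond `i` are enumerated in order by `e`. -/
theorem ici_prod {I : Type} [LinearOrder I] {i : I} {e : ℕ → I} (he : StrictMono e)
    (hrange : Set.range e = Set.Ioi i) (a : L) :
    Nonempty (Set.Ici (toLex (i, a) : I ×ₗ L) ≃o Set.Ici a ⊕ₗ (ℕ ×ₗ L)) := by
  have hlt : ∀ k, i < e k := fun k => (hrange ▸ Set.mem_range_self k : e k ∈ Set.Ioi i)
  refine nonempty_ici_orderIso_of_range (f := fun p : Set.Ici a ⊕ₗ (ℕ ×ₗ L) => Sum.elim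
    (fun b => toLex (i, b.1)) (fun q => toLex (e (ofLex q).1, (ofLex q).2)) (ofLex p)) ?_ ?_
  · intro p q h
    obtain ⟨p | p, rfl⟩ := toLex.surjective p <;> obtain ⟨q | q, rfl⟩ := toLex.surjective q
    · simpa [Prod.Lex.toLex_lt_toLex] using h
    · simp [Prod.Lex.toLex_lt_toLex, hlt]
    · simp at h
    · obtain ⟨⟨j, c⟩, rfl⟩ := toLex.surjective p
      obtain ⟨⟨k, d⟩, rfl⟩ := toLex.surjective q
      simpa [Prod.Lex.toLex_lt_toLex, he.lt_iff_lt, he.injective.eq_iff] using h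
  · ext p
    obtain ⟨⟨j, b⟩, rfl⟩ := toLex.surjective p
    simp only [Set.mem_range, Set.mem_Ici, Prod.Lex.toLex_le_toLex]
    constructor
    · rintro ⟨q, hq⟩
      obtain ⟨q | q, rfl⟩ := toLex.surjective q
      · simp only [ofLex_toLex, Sum.elim_inl, EmbeddingLike.apply_eq_iff_eq, Prod.mk.injEq] at hq
        exact Or.inr ⟨hq.1, hq.2 ▸ q.2⟩
      · simp only [ofLex_toLex, Sum.elim_inr, EmbeddingLike.apply_eq_iff_eq, Prod.mk.injEq] at hq
        exact Or.inl (hq.1 ▸ hlt _)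
    · rintro (h | ⟨rfl, h⟩)
      · obtain ⟨k, rfl⟩ : j ∈ Set.range e := hrange ▸ h
        exact ⟨toLex (Sum.inr (toLex (k, b))), rfl⟩
      · exact ⟨toLex (Sum.inl ⟨b, h⟩), rfl⟩

theorem ici_int_prod (i : ℤ) (a : L) :
    Nonempty (Set.Ici (toLex (i, a) : ℤ ×ₗ L) ≃o Set.Ici a ⊕ₗ (ℕ ×ₗ L)) := by
  refine ici_prod (e := fun k : ℕ => i + 1 + k) (fun j k h => by simpa using h) ?_ a
  ext j
  simp only [Set.mem_range, Set.mem_Ioi]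
  exact ⟨fun ⟨k, hk⟩ => by omega, fun h => ⟨(j - (i + 1)).toNat, by omega⟩⟩

theorem ici_nat_prod (i : ℕ) (a : L) :
    Nonempty (Set.Ici (toLex (i, a) : ℕ ×ₗ L) ≃o Set.Ici a ⊕ₗ (ℕ ×ₗ L)) := by
  refine ici_prod (e := fun k : ℕ => i + 1 + k) (fun j k h => by simpa using h) ?_ a
  ext j
  simp only [Set.mem_range, Set.mem_Ioi]
  exact ⟨fun ⟨k, hk⟩ => by omega, fun h => ⟨j - (i + 1), by omega⟩⟩

theorem ici_inl {X Y : Type*} [LinearOrder X] [LinearOrder Y] (x : X) :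
    Nonempty (Set.Ici (toLex (Sum.inl x) : X ⊕ₗ Y) ≃o Set.Ici x ⊕ₗ Y) := by
  refine nonempty_ici_orderIso_of_range (f := fun p : Set.Ici x ⊕ₗ Y =>
    toLex (Sum.map (fun b => b.1) id (ofLex p))) ?_ ?_
  · intro p q h
    obtain ⟨p | p, rfl⟩ := toLex.surjective p <;> obtain ⟨q | q, rfl⟩ := toLex.surjective q
    · simpa using h
    · simp
    · simp at h
    · simpa using h
  · ext p
    obtain ⟨p | p, rfl⟩ := toLex.surjective p <;> simp [Sum.exists, toLex.surjective.exists]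

theorem ici_inr {X Y : Type*} [LinearOrder X] [LinearOrder Y] (y : Y) :
    Nonempty (Set.Ici (toLex (Sum.inr y) : X ⊕ₗ Y) ≃o Set.Ici y) := by
  refine nonempty_ici_orderIso_of_range (f := fun p : Set.Ici y => toLex (Sum.inr p.1)) ?_ ?_
  · exact fun p q h => Sum.Lex.inr_lt_inr_iff.2 h
  · ext p
    obtain ⟨p | p, rfl⟩ := toLex.surjective p <;> simp

theorem ici_int_prod_of_isUniform (hL : IsUniform L) (p : ℤ ×ₗ L) (a : L) :
    Nonempty (Set.Ici p ≃o Set.Ici a ⊕ₗ (ℕ ×ₗ L)) := by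
  obtain ⟨⟨i, b⟩, rfl⟩ := toLex.surjective p
  exact ⟨(ici_int_prod i b).some.trans ((hL b a).some.sumLexCongr (OrderIso.refl _))⟩

theorem ici_sum_nat_prod_of_tailsIso (hL : IsUniform L) (hML : TailsIso M L)
    (p : M ⊕ₗ (ℕ ×ₗ L)) (a : L) : Nonempty (Set.Ici p ≃o Set.Ici a ⊕ₗ (ℕ ×ₗ L)) := by
  obtain ⟨b | q, rfl⟩ := toLex.surjective p
  · exact ⟨(ici_inl b).some.trans ((hML b a).some.sumLexCongr (OrderIso.refl _))⟩
  · obtain ⟨⟨i, b⟩, rfl⟩ := toLex.surjective q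
    exact ⟨(ici_inr _).some.trans
      ((ici_nat_prod i b).some.trans ((hL b a).some.sumLexCongr (OrderIso.refl _)))⟩

end Sums

/-! ### Decomposition of uniform chains of successor rank -/

section Decomposition

variable {A B : Type u} [LinearOrder A] [LinearOrder B]

/-- Components inherit the order of their points. -/
theorem lt_of_mem_component {β : Ordinal.{u}} {x y x' y' : A} (hxy : x < y)
    (hy : y ∉ component β x) (hx' : x' ∈ component β x) (hy' : y' ∈ component β y) : x' < y' := by
  by_contra! h
  rcases le_or_gt x y' with hle | hlt
  · refine hy (mem_component_trans ?_ (mem_component_comm.1 hy'))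
    exact (ordConnected_component β x).out (mem_component_self β x) hx' ⟨hle, h⟩
  · refine hy (mem_component_comm.1 ?_)
    exact (ordConnected_component β y).out hy' (mem_component_self β y) ⟨hlt.le, hxy.le⟩

/-- The `β`-components of a uniform chain of rank `β + 1` are indexed, in their order, by the
integers or by the natural numbers. -/
theorem UC.exists_index [Nonempty A] {β : Ordinal.{u}} (hA : UC A (β + 1)) :
    (∃ r : A → ℤ, Monotone r ∧ r.Surjective ∧ ∀ x y, r x = r y ↔ y ∈ component β x) ∨
    ∃ r : A → ℕ, Monotone r ∧ r.Surjective ∧ ∀ x y, r x = r y ↔ y ∈ component β x := by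
  classical
  -- the chain of components, realised as a chain of representatives
  let rep : A → A := fun x => Classical.epsilon (· ∈ component β x)
  have hrep : ∀ x, rep x ∈ component β x := fun x =>
    Classical.epsilon_spec (p := (· ∈ component β x)) ⟨x, mem_component_self β x⟩
  have hrep_eq : ∀ x y, rep x = rep y ↔ y ∈ component β x := by
    intro x y
    constructor
    · intro h
      exact mem_component_trans (hrep x) (h ▸ mem_component_comm.1 (hrep y))
    · intro h
      simp only [rep, component_eq_iff.2 h]
  have hmono : Monotone rep := by
    intro x y hxy
    by_cases h : y ∈ component β x
    · exact ((hrep_eq x y).2 h).le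
    · have hne : x ≠ y := by
        rintro rfl
        exact h (mem_component_self β x)
      exact (lt_of_mem_component (hxy.lt_of_ne hne) h (hrep x) (hrep y)).le
  let Q := Set.range rep
  let q : A → Q := Set.rangeFactorization rep
  have hqmono : Monotone q := fun x y h => hmono h
  have hqsurj : q.Surjective := Set.rangeFactorization_surjective
  have hq_eq : ∀ x y, q x = q y ↔ y ∈ component β x := fun x y =>
    Subtype.ext_iff.trans (hrep_eq x y)
  have : Nonempty Q := ⟨q (Classical.arbitrary A)⟩
  have hfin : ∀ a b : Q, (Set.Icc a b).Finite := by
    intro a b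
    obtain ⟨x, rfl⟩ := hqsurj a
    obtain ⟨y, rfl⟩ := hqsurj b
    have hxy : rep y ∈ component (β + 1) (rep x) := hA.2.1 (rep x) ▸ Set.mem_univ (rep y)
    rw [mem_component_add_one] at hxy
    refine Set.Finite.of_finite_image (hxy.subset ?_) (f := fun z : Q => component β z.1) ?_
    · rintro _ ⟨z, hz, rfl⟩
      exact ⟨z.1, Set.Icc_subset_uIcc ⟨hz.1, hz.2⟩, rfl⟩
    · intro z _ w _ h
      obtain ⟨x, rfl⟩ := hqsurj z
      obtain ⟨y, rfl⟩ := hqsurj w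
      refine (hq_eq x y).2 ?_
      exact mem_component_trans (hrep x) (mem_component_trans (component_eq_iff.1 h)
        (mem_component_comm.1 (hrep y)))
  let _ : LocallyFiniteOrder Q := LocallyFiniteOrder.ofFiniteIcc hfin
  have : NoMaxOrder Q := by
    refine ⟨fun a => ?_⟩
    obtain ⟨x, rfl⟩ := hqsurj a
    by_contra! hmax
    refine hA.2.2 β (Order.lt_add_one_iff.2 le_rfl) (hA.1.component_eq_univ (x := x) ?_)
    intro y hy
    exact (hq_eq x y).1 (le_antisymm (hqmono hy) (hmax (q y)))
  let _ : SuccOrder Q := LinearLocallyFiniteOrder.succOrder Q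
  let _ : PredOrder Q := LinearLocallyFiniteOrder.predOrder Q
  by_cases hbot : ∃ a : Q, ∀ b, a ≤ b
  · right
    obtain ⟨a, ha⟩ := hbot
    let _ : OrderBot Q := { bot := a, bot_le := ha }
    let e : Q ≃o ℕ := orderIsoNatOfLinearSuccPredArch
    exact ⟨e ∘ q, e.monotone.comp hqmono, e.surjective.comp hqsurj, fun x y =>
      e.injective.eq_iff.trans (hq_eq x y)⟩
  · left
    have : NoMinOrder Q := ⟨by simpa using hbot⟩
    let e : Q ≃o ℤ := orderIsoIntOfLinearSuccPredArch
    exact ⟨e ∘ q, e.monotone.comp hqmono, e.surjective.comp hqsurj, fun x y =>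
      e.injective.eq_iff.trans (hq_eq x y)⟩

/-- The `β`-component immediately above that of `x` (empty if there is none). -/
def nextComponent (β : Ordinal.{u}) (x : A) : Set A :=
  {z | x ≤ z ∧ z ∉ component β x ∧
    ∀ w, x ≤ w → w ≤ z → w ∈ component β x ∨ z ∈ component β w}

theorem preimage_singleton_eq_nextComponent {I : Type*} [LinearOrder I] {β : Ordinal.{u}}
    {r : A → I} (hr : Monotone r) (hsurj : r.Surjective)
    (hcomp : ∀ x y, r x = r y ↔ y ∈ component β x) {x : A} {i : I} (hi : r x ⋖ i) :
    r ⁻¹' {i} = nextComponent β x := by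
  ext z
  simp only [nextComponent, ← hcomp, Set.mem_preimage, Set.mem_singleton_iff]
  constructor
  · rintro rfl
    refine ⟨(hr.reflect_lt hi.lt).le, hi.lt.ne, fun w hxw hwz => ?_⟩
    rcases (hr hxw).eq_or_lt with h | h
    · exact Or.inl h
    · exact Or.inr ((hr hwz).eq_of_not_lt (hi.2 h))
  · rintro ⟨hxz, hne, hbetween⟩
    have hlt : r x < r z := (hr hxz).lt_of_ne hne
    by_contra hzi
    have hiz : i < r z := (hi.ge_of_gt hlt).lt_of_ne (Ne.symm hzi)
    obtain ⟨w, rfl⟩ := hsurj i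
    rcases hbetween w (hr.reflect_lt hi.lt).le (hr.reflect_lt hiz).le with h | h
    · exact hi.lt.ne h
    · exact hiz.ne h

theorem TailsIso.nonempty_nextComponent_orderIso (h : TailsIso A B) (β : Ordinal.{u}) (x : A)
    (y : B) :
    Nonempty (nextComponent β x ≃o nextComponent β y) := by
  obtain ⟨f, hf, himage, rfl, hcomp⟩ := exists_tail_map (h x y)
  refine nonempty_orderIso_image (hf.mono fun z hz => hz.1) ?_
  have hmem : ∀ z, x ≤ z →
      (f z ∈ nextComponent β (f x) ↔ z ∈ nextComponent β x) := by
    intro z hz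
    have hfz : f x ≤ f z := hf.monotoneOn Set.self_mem_Ici hz hz
    have hforall : (∀ w, f x ≤ w → w ≤ f z → w ∈ component β (f x) ∨ f z ∈ component β w) ↔
        ∀ w, x ≤ w → w ≤ z → w ∈ component β x ∨ z ∈ component β w := by
      constructor
      · intro H w hxw hwz
        rw [← hcomp β x le_rfl w hxw, ← hcomp β w hxw z hz]
        exact H (f w) (hf.monotoneOn Set.self_mem_Ici hxw hxw) (hf.monotoneOn hxw hz hwz)
      · intro H w hxw hwz
        obtain ⟨v, hv, rfl⟩ : w ∈ f '' Set.Ici x := himage ▸ hxw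
        rw [hcomp β x le_rfl v hv, hcomp β v hv z hz]
        exact H v hv ((hf.le_iff_le hv hz).1 hwz)
    simp only [nextComponent, Set.mem_ofPred_eq, hcomp β x le_rfl z hz, hforall, hz,
      hfz]
  ext w
  constructor
  · rintro ⟨z, hz, rfl⟩
    exact (hmem z hz.1).2 hz
  · intro hw
    obtain ⟨z, hz, rfl⟩ : w ∈ f '' Set.Ici x := himage ▸ hw.1
    exact ⟨z, (hmem z hz).1 hw, rfl⟩

theorem TailsIso.tailsIso_component (h : TailsIso A B) (β : Ordinal.{u}) (x : A) (y : B) :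
    TailsIso (component β x) (component β y) := by
  have key : ∀ {C : Type u} [LinearOrder C] (z : C) (p : component β z),
      Nonempty (Set.Ici p ≃o (Set.Ici p.1 ∩ component β p.1 : Set C)) := by
    intro C _ z p
    rw [← component_eq_iff.2 p.2]
    refine nonempty_ici_orderIso_of_range
      (f := fun c : (Set.Ici p.1 ∩ component β z : Set C) => ⟨c.1, c.2.2⟩)
      (fun c d h => h) ?_
    ext c
    exact ⟨fun ⟨d, hd⟩ => hd ▸ d.2.1, fun hc => ⟨⟨c.1, hc, c.2⟩, rfl⟩⟩
  intro p q
  obtain ⟨f, hf, himage, hfp, hcomp⟩ := exists_tail_map (h p.1 q.1)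
  refine ⟨(key x p).some.trans (OrderIso.trans (Nonempty.some ?_) (key y q).some.symm)⟩
  refine nonempty_orderIso_image (hf.mono Set.inter_subset_left) ?_
  ext w
  constructor
  · rintro ⟨z, ⟨hz, hzc⟩, rfl⟩
    refine ⟨himage ▸ Set.mem_image_of_mem f hz, ?_⟩
    rw [← hfp]
    exact (hcomp β _ le_rfl z hz).2 hzc
  · rintro ⟨hw, hwc⟩
    obtain ⟨z, hz, rfl⟩ : w ∈ f '' Set.Ici p.1 := himage ▸ hw
    rw [← hfp] at hwc
    exact ⟨z, ⟨hz, (hcomp β _ le_rfl z hz).1 hwc⟩, rfl⟩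

/-- The `β`-components of a uniform chain of rank `β + 1` are uniform chains of rank `β`. -/
theorem UC.uc_component {β : Ordinal.{u}} (hA : UC A (β + 1)) (x : A) : UC (component β x) β := by
  refine ⟨TailsIso.tailsIso_component hA.1 β x x, ?_⟩
  have hcomp : ∀ (γ : Ordinal.{u}) (z w : component β x),
      w.1 ∈ component γ z.1 ↔ w ∈ component γ z := fun γ z w =>
    mem_component_map_iff (f := Subtype.val) ((Subtype.strictMono_coe _).strictMonoOn Set.univ)
      Set.ordConnected_univ (by simpa using ordConnected_component β x) γ z trivial w trivial
  constructor
  · intro z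
    refine Set.eq_univ_of_forall fun w => (hcomp β z w).1 ?_
    exact mem_component_trans (mem_component_comm.1 z.2) w.2
  · intro γ hγ h
    -- the `γ`-components would be the `β`-components, and the rank of `A` at most `γ + 1`
    have hsub : ∀ y : A, component β y ⊆ component γ y := by
      refine hA.1.component_subset_component (x := x) ?_
      rintro z ⟨-, hz⟩
      refine (hcomp γ ⟨x, mem_component_self β x⟩ ⟨z, hz⟩).2 ?_
      rw [h]
      trivial
    have heq : component γ = component (A := A) β := by
      funext y
      exact (component_mono hγ.le y).antisymm (hsub y)
    refine hA.2.2 (γ + 1) (by simpa using hγ) fun y => Set.eq_univ_of_forall fun z => ?_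
    have hz : z ∈ component (β + 1) y := hA.2.1 y ▸ Set.mem_univ z
    rw [mem_component_add_one] at hz ⊢
    rwa [heq]

theorem nonempty_orderIso_prod {I : Type} [LinearOrder I] {L : Type u} [LinearOrder L] {r : B → I}
    (hr : Monotone r) (e : ∀ i, L ≃o r ⁻¹' {i}) : Nonempty (B ≃o I ×ₗ L) := by
  have he : ∀ i a, r (e i a) = i := fun i a => (e i a).2
  have hmono : StrictMono fun p : I ×ₗ L => (e (ofLex p).1 (ofLex p).2 : B) := by
    intro p q h
    obtain ⟨⟨i, a⟩, rfl⟩ := toLex.surjective p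
    obtain ⟨⟨j, b⟩, rfl⟩ := toLex.surjective q
    rcases Prod.Lex.toLex_lt_toLex.1 h with h | ⟨rfl, h⟩
    · exact hr.reflect_lt ((he i a).trans_lt (h.trans_eq (he j b).symm))
    · exact (e i).strictMono h
  refine ⟨(hmono.orderIsoOfSurjective _ fun x => ?_).symm⟩
  exact ⟨toLex (r x, (e (r x)).symm ⟨x, rfl⟩),
    congrArg Subtype.val ((e (r x)).apply_symm_apply ⟨x, rfl⟩)⟩

theorem nonempty_orderIso_sum_prod {L : Type u} [LinearOrder L] {r : B → ℕ}
    (hr : Monotone r) (e : ∀ i, L ≃o r ⁻¹' {i + 1}) :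
    Nonempty (B ≃o (r ⁻¹' {0} : Set B) ⊕ₗ (ℕ ×ₗ L)) := by
  have he : ∀ i a, r (e i a) = i + 1 := fun i a => (e i a).2
  have hmono : StrictMono fun p : (r ⁻¹' {0} : Set B) ⊕ₗ (ℕ ×ₗ L) =>
      Sum.elim (fun x => x.1) (fun q => (e (ofLex q).1 (ofLex q).2 : B)) (ofLex p) := by
    intro p q h
    obtain ⟨p | p, rfl⟩ := toLex.surjective p <;> obtain ⟨q | q, rfl⟩ := toLex.surjective q
    · simpa using h
    · refine hr.reflect_lt ?_
      have hp : r p.1 = 0 := p.2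
      simp [he, hp]
    · simp at h
    · obtain ⟨⟨i, a⟩, rfl⟩ := toLex.surjective p
      obtain ⟨⟨j, b⟩, rfl⟩ := toLex.surjective q
      rcases Prod.Lex.toLex_lt_toLex.1 (Sum.Lex.inr_lt_inr_iff.1 h) with h | ⟨rfl, h⟩
      · exact hr.reflect_lt ((he i a).trans_lt ((Nat.succ_lt_succ h).trans_eq (he j b).symm))
      · exact (e i).strictMono h
  refine ⟨(hmono.orderIsoOfSurjective _ fun x => ?_).symm⟩
  rcases h : r x with _ | i
  · exact ⟨toLex (Sum.inl ⟨x, h⟩), rfl⟩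
  · exact ⟨toLex (Sum.inr (toLex (i, (e i).symm ⟨x, h⟩))),
      congrArg Subtype.val ((e i).apply_symm_apply ⟨x, h⟩)⟩

/-- The tails of a uniform chain of rank `β + 1` determine the uniform chain `L` of rank `β` of which
copies are repeated. All that is left open is whether there is a first `β`-component, and which. -/
theorem UC.exists_decomposition [Nonempty A] {β : Ordinal.{u}} (hA : UC A (β + 1)) :
    ∃ (L : Type u) (_ : LinearOrder L), Nonempty L ∧ UC L β ∧
      ∀ (B : Type u) [LinearOrder B], Nonempty B → UC B (β + 1) → TailsIso A B →
        Nonempty (B ≃o ℤ ×ₗ L) ∨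
        ∃ (M : Type u) (_ : LinearOrder M), Nonempty M ∧ UC M β ∧ TailsIso M L ∧
          Nonempty (B ≃o M ⊕ₗ (ℕ ×ₗ L)) := by
  let x : A := Classical.arbitrary A
  obtain ⟨z, hz⟩ : ∃ z, nextComponent β x = component β z := by
    have key : ∀ {I : Type} [LinearOrder I] (r : A → I) (i : I), Monotone r → r.Surjective →
        (∀ x y, r x = r y ↔ y ∈ component β x) → r x ⋖ i →
        ∃ z, nextComponent β x = component β z := by
      intro I _ r i hr hsurj hcomp hi
      obtain ⟨z, rfl⟩ := hsurj i
      refine ⟨z, ?_⟩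
      rw [← preimage_singleton_eq_nextComponent hr hsurj hcomp hi]
      ext w
      exact eq_comm.trans (hcomp z w)
    rcases hA.exists_index with ⟨r, hr, hsurj, hcomp⟩ | ⟨r, hr, hsurj, hcomp⟩
    · exact key r (r x + 1) hr hsurj hcomp (Order.covBy_add_one _)
    · exact key r (r x + 1) hr hsurj hcomp (Order.covBy_add_one _)
  refine ⟨component β z, inferInstance, ⟨z, mem_component_self β z⟩, hA.uc_component z, ?_⟩
  intro B _ _ hB hAB
  have hnext : ∀ y : B, Nonempty (component β z ≃o nextComponent β y) := fun y =>
    hz ▸ hAB.nonempty_nextComponent_orderIso β x y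
  rcases hB.exists_index with ⟨r, hr, hsurj, hcomp⟩ | ⟨r, hr, hsurj, hcomp⟩
  · left
    refine nonempty_orderIso_prod hr fun i => Nonempty.some ?_
    obtain ⟨y, hy⟩ := hsurj (i - 1)
    rw [preimage_singleton_eq_nextComponent hr hsurj hcomp (x := y)]
    · exact hnext y
    · rw [hy]
      simp
  · right
    obtain ⟨y, hy⟩ := hsurj 0
    have h0 : r ⁻¹' {0} = component β y := by
      ext w
      exact ⟨fun hw => (hcomp y w).1 (hy.trans hw.symm), fun hw => ((hcomp y w).2 hw).symm.trans hy⟩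
    refine ⟨component β y, inferInstance, ⟨y, mem_component_self β y⟩, hB.uc_component y,
      hAB.symm.tailsIso_component β y z, ?_⟩
    rw [← h0]
    refine nonempty_orderIso_sum_prod hr fun i => Nonempty.some ?_
    obtain ⟨y, hy⟩ := hsurj i
    rw [preimage_singleton_eq_nextComponent hr hsurj hcomp (x := y)]
    · exact hnext y
    · rw [hy]
      exact Order.covBy_add_one i

end Decomposition

/-! ### The chains of tagged arrays -/

/-- The chain obtained from the binary tree with root `⟨s; k⟩` by putting `U j` at the leaves of
weight `j`. For `k = 0` this is `shortChain s U`; a general `k` makes the recursion self-contained. -/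
def tagChain : {n : ℕ} → (Fin (n + 1) → ℕ) → ℕ → (ℕ → LinOrd.{u}) → LinOrd.{u}
  | 0, _, k, U => U k
  | n + 1, s, k, U =>
    if s (Fin.last (n + 1)) < n + 1 then
      LinOrd.of (tagChain (plus s) (k + 1) U ⊕ₗ (ℕ ×ₗ tagChain (minus s) 0 U))
    else
      LinOrd.of (ℤ ×ₗ tagChain (minus s) 0 U)

theorem tagChain_zero (s : Fin 1 → ℕ) (k : ℕ) (U : ℕ → LinOrd.{u}) : tagChain s k U = U k :=
  rfl

theorem tagChain_of_lt {n : ℕ} {s : Fin (n + 2) → ℕ} (hs : s (Fin.last (n + 1)) < n + 1) (k : ℕ)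
    (U : ℕ → LinOrd.{u}) : tagChain s k U =
      LinOrd.of (tagChain (plus s) (k + 1) U ⊕ₗ (ℕ ×ₗ tagChain (minus s) 0 U)) :=
  if_pos hs

theorem tagChain_of_not_lt {n : ℕ} {s : Fin (n + 2) → ℕ} (hs : ¬ s (Fin.last (n + 1)) < n + 1)
    (k : ℕ) (U : ℕ → LinOrd.{u}) :
    tagChain s k U = LinOrd.of (ℤ ×ₗ tagChain (minus s) 0 U) :=
  if_neg hs

theorem length_leafWeights {n : ℕ} (s : Fin (n + 1) → ℕ) (k l : ℕ) :
    (leafWeights s k).length = (leafWeights s l).length := by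
  induction n generalizing k l with
  | zero => rfl
  | succ n ih =>
    unfold leafWeights
    split_ifs
    · rw [List.length_append, List.length_append, ih (plus s) (k + 1) (l + 1)]
    · rfl

/-- The shift of indices in `longChain` matches the concatenation in `leafWeights`, because the number
of leaves does not depend on the weight of the root. -/
theorem longChain_eq_tagChain {n : ℕ} (s : Fin (n + 1) → ℕ) (k : ℕ) (M U : ℕ → LinOrd.{u})
    (h : ∀ i < (leafWeights s k).length, M i = U ((leafWeights s k).getD i 0)) :
    longChain s M = tagChain s k U := by
  induction n generalizing k M with
  | zero => exact h 0 (by simp [leafWeights])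
  | succ n ih =>
    unfold longChain tagChain
    unfold leafWeights at h
    split_ifs at h ⊢ with hs
    · rw [ih (plus s) (k + 1) M fun i hi => ?_, ih (minus s) 0 _ fun i hi => ?_]
      · rw [h _ (by simp [lf, length_leafWeights (plus s) 0 (k + 1), hi]),
          List.getD_append_right _ _ _ _
            (by simp [lf, length_leafWeights (plus s) 0 (k + 1)])]
        simp [lf, length_leafWeights (plus s) 0 (k + 1)]
      · rw [h i (by rw [List.length_append]; omega), List.getD_append _ _ _ _ hi]
    · rw [ih (minus s) 0 M h]

theorem mem_rwt_iff {n : ℕ} (s : Fin (n + 1) → ℕ) (k : ℕ) : k ∈ rwt s ↔ k ∈ leafWeights s 0 := by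
  rw [List.mem_iff_getElem]
  constructor
  · rintro ⟨i, hi, rfl⟩
    exact ⟨i, hi, (List.getD_eq_getElem _ 0 hi).symm⟩
  · rintro ⟨i, hi, rfl⟩
    exact ⟨i, hi, List.getD_eq_getElem _ 0 hi⟩

theorem wt_mem_rwt {n : ℕ} (s : Fin (n + 1) → ℕ) {i : ℕ} (hi : i < lf s) : wt s i ∈ rwt s :=
  ⟨i, hi, rfl⟩

/-- The rightmost leaf has weight `0`. -/
theorem zero_mem_rwt {n : ℕ} (s : Fin (n + 1) → ℕ) : 0 ∈ rwt s := by
  rw [mem_rwt_iff]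
  induction n with
  | zero => simp [leafWeights]
  | succ n ih =>
    unfold leafWeights
    split_ifs
    · exact List.mem_append_right _ (ih (minus s))
    · exact ih (minus s)

theorem shortChain_eq_tagChain {n : ℕ} (s : Fin (n + 1) → ℕ) {U V : ℕ → LinOrd.{u}}
    (h : ∀ k ∈ rwt s, U k = V k) : shortChain s U = tagChain s 0 V :=
  longChain_eq_tagChain s 0 _ _ fun _ hi => h _ (wt_mem_rwt s hi)

theorem UC.nonempty {A : Type u} [LinearOrder A] {α : Ordinal.{u}} (hA : UC A α) (hα : α ≠ 0) :
    Nonempty A := by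
  by_contra hempty
  rw [not_nonempty_iff] at hempty
  exact hA.2.2 0 (pos_iff_ne_zero.2 hα) fun x => hempty.elim x

theorem omega0_add_natCast_ne_zero (n : ℕ) : (ω + n : Ordinal.{u}) ≠ 0 :=
  (omega0_pos.trans_le (le_add_right le_rfl)).ne'

theorem omega0_add_natCast_succ (n : ℕ) : (ω + (n + 1 : ℕ) : Ordinal.{u}) = ω + n + 1 := by
  rw [Nat.cast_add, Nat.cast_one, add_assoc]

/-- The tails of the chain of `s` do not depend on the last entry of `s`; this is what makes the
sums `A(s⁺) + A(s⁻) · ℕ` uniform. -/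
theorem uc_tagChain {U : ℕ → LinOrd.{u}} (hU : ∀ k, UC (U k) ω)
    (hUU : ∀ k l, TailsIso (U k) (U l)) (n : ℕ) :
    (∀ (s : Fin (n + 1) → ℕ) (k : ℕ), UC (tagChain s k U) (ω + n)) ∧
    ∀ (s s' : Fin (n + 1) → ℕ) (k k' : ℕ), (∀ i : Fin (n + 1), (i : ℕ) < n → s i = s' i) →
      TailsIso (tagChain s k U) (tagChain s' k' U) := by
  induction n with
  | zero =>
    refine ⟨fun s k => ?_, fun s s' k k' _ => hUU k k'⟩
    rw [Nat.cast_zero, add_zero]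
    exact hU k
  | succ n ih =>
    obtain ⟨ihUC, ihT⟩ := ih
    have hne : ∀ (s : Fin (n + 1) → ℕ) (k : ℕ), Nonempty (tagChain s k U) := fun s k =>
      (ihUC s k).nonempty (omega0_add_natCast_ne_zero n)
    -- `s⁺` and `s⁻` differ in their last entries only
    have hML : ∀ (s : Fin (n + 2) → ℕ) (k : ℕ),
        TailsIso (tagChain (plus s) (k + 1) U) (tagChain (minus s) 0 U) := by
      intro s k
      refine ihT _ _ _ _ fun i hi => ?_
      have hne : i ≠ Fin.last n := fun h => by simp [h] at hi
      simp [plus, minus, Function.update_of_ne hne]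
    have htail : ∀ (s : Fin (n + 2) → ℕ) (k : ℕ) (p : tagChain s k U)
        (a : tagChain (minus s) 0 U),
        Nonempty (Set.Ici p ≃o Set.Ici a ⊕ₗ (ℕ ×ₗ tagChain (minus s) 0 U)) := by
      intro s k
      by_cases hs : s (Fin.last (n + 1)) < n + 1
      · rw [tagChain_of_lt hs]
        exact ici_sum_nat_prod_of_tailsIso (ihUC _ 0).1 (hML s k)
      · rw [tagChain_of_not_lt hs]
        exact ici_int_prod_of_isUniform (ihUC _ 0).1
    have hT : ∀ (s s' : Fin (n + 2) → ℕ) (k k' : ℕ),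
        (∀ i : Fin (n + 2), (i : ℕ) < n + 1 → s i = s' i) →
        TailsIso (tagChain s k U) (tagChain s' k' U) := by
      intro s s' k k' hs p p'
      have hminus : minus s = minus s' := funext fun i => hs _ (by simp; omega)
      obtain ⟨a⟩ := hne (minus s) 0
      have h := htail s k p a
      have h' := htail s' k' p'
      rw [← hminus] at h'
      exact ⟨h.some.trans (h' a).some.symm⟩
    refine ⟨fun s k => ⟨hT s s k k fun _ _ => rfl, ?_⟩, hT⟩
    have := hne (minus s) 0
    have := hne (plus s) (k + 1)
    rw [omega0_add_natCast_succ]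
    by_cases hs : s (Fin.last (n + 1)) < n + 1
    · rw [tagChain_of_lt hs]
      exact hasRank_sum_nat_prod (ihUC _ _) (ihUC _ _)
    · rw [tagChain_of_not_lt hs]
      exact hasRank_int_prod (ihUC _ _)

theorem uc_shortChain {n : ℕ} {s : Fin (n + 1) → ℕ} {U : ℕ → LinOrd.{u}}
    (hU : IsTaggedShortArray s U) : UC (shortChain s U) (ω + n) := by
  classical
  -- the entries of weights that do not occur are irrelevant, and may be taken to be `U 0`
  let V : ℕ → LinOrd.{u} := fun k => U (if k ∈ rwt s then k else 0)
  have hmem : ∀ k, (if k ∈ rwt s then k else 0) ∈ rwt s := by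
    intro k
    split_ifs with h
    · exact h
    · exact zero_mem_rwt s
  rw [shortChain_eq_tagChain s (V := V) fun k hk => by simp [V, hk]]
  exact (uc_tagChain (fun k => hU.1 _ (hmem k)) (fun k l => hU.2 _ (hmem k) _ (hmem l)) n).1 s 0

/-- All uniform chains of rank `ω + n` with the tails of `A` are the chains of one sequence and one
array, up to the last entry of the sequence and the entry `W` of the array of index `n`. In the tree
with root `⟨s; k⟩` that entry belongs at the leaf of weight `n + k`. -/
theorem exists_tagChain (n : ℕ) (A : Type u) [LinearOrder A] (hA : UC A (ω + n)) :
    ∃ (T : LinOrd.{u}) (s : Fin (n + 1) → ℕ) (U : ℕ → LinOrd.{u}), UC T ω ∧ s ∈ SS (n + 1) ∧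
      (∀ m, UC (U m) ω ∧ TailsIso T (U m)) ∧
      ∀ (B : Type u) [LinearOrder B], UC B (ω + n) → TailsIso A B →
        ∃ j ≤ n, ∃ W : LinOrd.{u}, UC W ω ∧ TailsIso T W ∧
          ∀ (k : ℕ) (V : ℕ → LinOrd.{u}), (∀ m < n, V m = U m) → V (n + k) = W →
            Nonempty (B ≃o tagChain (Function.update s (Fin.last n) j) k V) := by
  induction n generalizing A with
  | zero =>
    have hA' : UC A ω := by simpa using hA
    refine ⟨LinOrd.of A, fun _ => 0, fun _ => LinOrd.of A, hA', fun _ => Nat.zero_le _,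
      fun _ => ⟨hA', hA'.1⟩, fun B _ hB hAB => ?_⟩
    refine ⟨0, le_rfl, LinOrd.of B, by simpa using hB, hAB, fun k V _ hV => ?_⟩
    rw [Nat.zero_add] at hV
    rw [tagChain_zero, hV]
    exact ⟨OrderIso.refl B⟩
  | succ n ih =>
    have := hA.nonempty (omega0_add_natCast_ne_zero _)
    rw [omega0_add_natCast_succ] at hA
    obtain ⟨L, _, _, hL, hdec⟩ := hA.exists_decomposition
    obtain ⟨T, s, U, hT, hs, hU, hall⟩ := ih L hL
    obtain ⟨j₀, hj₀, W₀, hW₀, hTW₀, hL'⟩ := hall L hL hL.1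
    -- the data for `L` are those for `A`; the last entry of the sequence, here `0`, stays open
    let s₀ : Fin (n + 1) → ℕ := Function.update s (Fin.last n) j₀
    have hminus : ∀ j, minus (Function.update (Fin.snoc s₀ 0 : Fin (n + 2) → ℕ)
        (Fin.last (n + 1)) j) = s₀ := by
      intro j
      simp [minus]
    have hplus : ∀ j, plus (Function.update (Fin.snoc s₀ 0 : Fin (n + 2) → ℕ)
        (Fin.last (n + 1)) j) = Function.update s (Fin.last n) j := by
      intro j
      simp [plus, s₀]
    refine ⟨T, Fin.snoc s₀ 0, Function.update U n W₀, hT, ?_, ?_, ?_⟩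
    · intro i
      refine Fin.lastCases ?_ (fun i => ?_) i
      · simp
      · rw [Fin.snoc_castSucc, Fin.val_castSucc]
        by_cases hi : i = Fin.last n
        · subst hi
          simpa [s₀] using hj₀
        · simpa [s₀, hi] using hs i
    · intro m
      by_cases hm : m = n
      · subst hm
        rw [Function.update_self]
        exact ⟨hW₀, hTW₀⟩
      · rw [Function.update_of_ne hm]
        exact hU m
    · intro B _ hB hAB
      have := hB.nonempty (omega0_add_natCast_ne_zero _)
      rw [omega0_add_natCast_succ] at hB
      have hV₀ : ∀ V : ℕ → LinOrd.{u}, (∀ m < n + 1, V m = Function.update U n W₀ m) →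
          (∀ m < n, V m = U m) ∧ V (n + 0) = W₀ := by
        intro V hV
        refine ⟨fun m hm => ?_, ?_⟩
        · rw [hV m (by omega), Function.update_of_ne hm.ne]
        · simpa using hV n (by omega)
      -- in the first case the open entry of the array does not occur, and `W₀` fills it; in the second
      -- it sits in `M`, one step further left in the tree
      rcases hdec B this hB hAB with ⟨⟨e⟩⟩ | ⟨M, _, _, hM, hML, ⟨e⟩⟩
      · refine ⟨n + 1, le_rfl, W₀, hW₀, hTW₀, fun k V hV _ => ?_⟩
        obtain ⟨eL⟩ := hL' 0 V (hV₀ V hV).1 (hV₀ V hV).2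
        rw [tagChain_of_not_lt (by simp), hminus]
        exact ⟨e.trans (Prod.Lex.prodLexCongr (OrderIso.refl ℤ) eL)⟩
      · obtain ⟨j, hj, W, hW, hTW, hM'⟩ := hall M hM hML.symm
        refine ⟨j, hj.trans n.le_succ, W, hW, hTW, fun k V hV hVW => ?_⟩
        obtain ⟨eL⟩ := hL' 0 V (hV₀ V hV).1 (hV₀ V hV).2
        obtain ⟨eM⟩ := hM' (k + 1) V (hV₀ V hV).1 (by rw [← hVW]; congr 1; omega)
        rw [tagChain_of_lt (by simpa using Nat.lt_succ_of_le hj), hminus, hplus]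
        exact ⟨e.trans (eM.sumLexCongr (Prod.Lex.prodLexCongr (OrderIso.refl ℕ) eL))⟩

theorem exists_shortChain (n : ℕ) (A : Type u) [LinearOrder A] (hA : UC A (ω + n)) :
    ∃ (s : Fin (n + 1) → ℕ) (U : ℕ → LinOrd.{u}), s ∈ SS (n + 1) ∧ IsTaggedShortArray s U ∧
      Nonempty (A ≃o shortChain s U) := by
  obtain ⟨T, s, U, hT, hs, hU, hall⟩ := exists_tagChain n A hA
  obtain ⟨j, hj, W, hW, hTW, hiso⟩ := hall A hA hA.1
  have hV : ∀ m, UC (Function.update U n W m) ω ∧ TailsIso T (Function.update U n W m) := by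
    intro m
    by_cases hm : m = n
    · subst hm
      rw [Function.update_self]
      exact ⟨hW, hTW⟩
    · rw [Function.update_of_ne hm]
      exact hU m
  have := hT.nonempty omega0_ne_zero
  refine ⟨Function.update s (Fin.last n) j, Function.update U n W, fun i => ?_,
    ⟨fun k _ => (hV k).1, fun k _ l _ => (hV k).2.symm.trans (hV l).2⟩, ?_⟩
  · by_cases hi : i = Fin.last n
    · subst hi
      simpa using hj
    · simpa [hi] using hs i
  · rw [shortChain_eq_tagChain _ fun _ _ => rfl]
    exact hiso 0 _ (fun m hm => Function.update_of_ne hm.ne _ _) (by simp)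

end UniformChain

theorem mainTheorem3 :
    (∀ (n : ℕ) (s : Fin (n + 1) → ℕ) (U : ℕ → LinOrd.{u}),
      s ∈ UniformChain.SS (n + 1) → UniformChain.IsTaggedShortArray s U →
        UniformChain.UC (UniformChain.shortChain s U) (Ordinal.omega0 + (n : Ordinal.{u}))) ∧
    (∀ (A : Type u) [LinearOrder A] (α : Ordinal.{u}),
      Ordinal.omega0 ≤ α → α < Ordinal.omega0 + Ordinal.omega0 → UniformChain.UC A α →
        ∃ (n : ℕ) (s : Fin (n + 1) → ℕ) (U : ℕ → LinOrd.{u}),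
          α = Ordinal.omega0 + (n : Ordinal.{u}) ∧ s ∈ UniformChain.SS (n + 1) ∧
          UniformChain.IsTaggedShortArray s U ∧
          Nonempty (A ≃o UniformChain.shortChain s U)) := by
  refine ⟨fun n s U _ hU => UniformChain.uc_shortChain hU, fun A _ α hα hα' hA => ?_⟩
  rw [← Ordinal.add_sub_cancel_of_le hα] at hA hα'
  obtain ⟨n, hn⟩ := Ordinal.lt_omega0.1 (lt_of_add_lt_add_left hα')
  rw [hn] at hA
  obtain ⟨s, U, hs, hU, hiso⟩ := UniformChain.exists_shortChain n A hA
  exact ⟨n, s, U, by rw [← hn, Ordinal.add_sub_cancel_of_le hα], hs, hU, hiso⟩
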